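/- Let $F$ be a finite 4-regular graph (loops and parallel edges allowed, $F$ not necessarily connected), where each edge consists of two distinct half-edges. Circuits of $F$ (closed trails) are oriented, and are considered up to cyclic permutation but not up to reversal. An Euler system of $F$ consists of one Euler circuit for each connected component of $F$; following its circuits gives every edge of $F$ a direction, and another Euler system respects these edge directions if each of its circuits traverses every one of its edges in the given direction. Let $C$ be a signed version of an Euler system of $F$, i.e. for each vertex $v$ one of the two passages of $C$ through $v$ is designated $v^+$ and the other $v^-$. Let $\mathcal{I}_{\mathbb{R}}(C)$ be the real $V(F)\times V(F)$ matrix whose diagonal entries are $0$ and whose $vw$ entry, for $v\neq w$, is $1$ if $v$ and $w$ occur on a circuit of $C$ in the cyclic order $v^+w^-v^-w^+$, is $-1$ if they occur on a circuit of $C$ in the cyclic order $v^+w^+v^-w^-$, and is $0$ if $v$ and $w$ are not interlaced on $C$ (i.e. otherwise). Then the number of Euler systems of $F$ that respect the edge directions defined by $C$ is $$\det\bigl(I+\mathcal{I}_{\mathbb{R}}(C)\bigr),$$ where $I$ is the $V(F)\times V(F)$ identity matrix. -/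

import Mathlib

/-- A graph (loops and parallel edges allowed) with vertex set `V`, given by its half-edges.
An edge is a pair `{h, opp h}` of distinct half-edges, and `vert h` is the vertex on which `h`
is incident.  A direction of the edge `{h, opp h}` is the choice of one of `h`, `opp h` as its
initial half-edge, so a half-edge `h` also stands for the edge `{h, opp h}` directed from
`vert h` to `vert (opp h)`. -/
structure HalfEdgeGraph (V H : Type*) where
  vert : H → V
  opp : H → H
  opp_opp : ∀ h, opp (opp h) = h
  opp_ne : ∀ h, opp h ≠ h

namespace HalfEdgeGraph

variable {V H : Type*}

/-- Every vertex is incident with exactly `d` half-edges. -/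
def IsRegular (F : HalfEdgeGraph V H) (d : ℕ) : Prop :=
  ∀ v : V, Nat.card {h : H // F.vert h = v} = d

/-- The underlying simple graph; it is used only to speak of connected components. -/
def toSimpleGraph (F : HalfEdgeGraph V H) : SimpleGraph V :=
  SimpleGraph.fromRel fun v w => ∃ h : H, F.vert h = v ∧ F.vert (F.opp h) = w

/-- The connected components of the graph. -/
abbrev Component (F : HalfEdgeGraph V H) : Type _ :=
  F.toSimpleGraph.ConnectedComponent

/-- The connected component that contains the edge `{h, opp h}`. -/
def componentOf (F : HalfEdgeGraph V H) (h : H) : F.Component :=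
  F.toSimpleGraph.connectedComponentMk (F.vert h)

/-- A circuit, i.e. a closed trail, taken up to cyclic permutation but not up to reversal.
It is recorded by the cyclic sequence `h₁, h₂, …` of the initial half-edges of its directed
edges: each edge ends where the next one starts, and no edge occurs twice. -/
def IsCircuit (F : HalfEdgeGraph V H) (c : Cycle H) : Prop :=
  c.Chain (fun h h' => F.vert (F.opp h) = F.vert h') ∧ c.Nodup ∧ ∀ h ∈ c, F.opp h ∉ c

/-- An Euler circuit of the component `K`: a circuit in which every edge of `K`, and no edge of
another component, appears (exactly once, since a circuit does not repeat edges). -/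
def IsEulerCircuit (F : HalfEdgeGraph V H) (K : F.Component) (c : Cycle H) : Prop :=
  F.IsCircuit c ∧ ∀ h : H, (h ∈ c ∨ F.opp h ∈ c) ↔ F.componentOf h = K

/-- An Euler system: one Euler circuit for each connected component. -/
structure EulerSystem (F : HalfEdgeGraph V H) where
  circuit : F.Component → Cycle H
  isEulerCircuit : ∀ K : F.Component, F.IsEulerCircuit K (circuit K)

/-- The edge directions defined by an Euler system, as the set of half-edges that are the initial
half-edges of their edges when the circuits are followed.  A half-edge `h` in this set with
`vert h = v` also stands for a passage of a circuit of `C` through `v`, namely the one that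
leaves `v` along `h`. -/
def EulerSystem.initialHalfEdges {F : HalfEdgeGraph V H} (C : F.EulerSystem) : Set H :=
  {h | ∃ K : F.Component, h ∈ C.circuit K}

/-- The Euler system `C'` respects the edge directions defined by `C`: every edge that a circuit
of `C'` traverses is traversed in the direction in which `C` traverses it. -/
def EulerSystem.RespectsDirectionsOf {F : HalfEdgeGraph V H} (C' C : F.EulerSystem) : Prop :=
  ∀ K : F.Component, ∀ h ∈ C'.circuit K, h ∈ C.initialHalfEdges

/-- A signed version of an Euler system: for each vertex `v`, one passage of the Euler system
through `v` is designated `v⁺` and another one `v⁻`.  (In a 4-regular graph there are exactly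
two passages through each vertex.)  Passages are named by their outgoing half-edges. -/
structure SignedEulerSystem (F : HalfEdgeGraph V H) extends EulerSystem F where
  plus : V → H
  minus : V → H
  plus_mem : ∀ v, plus v ∈ toEulerSystem.initialHalfEdges
  minus_mem : ∀ v, minus v ∈ toEulerSystem.initialHalfEdges
  vert_plus : ∀ v, F.vert (plus v) = v
  vert_minus : ∀ v, F.vert (minus v) = v
  plus_ne_minus : ∀ v, plus v ≠ minus v

/-- The passages listed in `s` occur in this order on one of the circuits of `C`, when that
circuit is followed once around from a suitable starting point. -/
def EulerSystem.OccurInOrder {F : HalfEdgeGraph V H} (C : F.EulerSystem) (s : List H) : Prop :=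
  ∃ (K : F.Component) (l : List H), (l : Cycle H) = C.circuit K ∧ s.Sublist l

open Classical in
/-- The signed interlacement matrix: the diagonal is zero, and for `v ≠ w` the `v w` entry is `1`
if the order on `C` is `v⁺ w⁻ v⁻ w⁺`, it is `-1` if the order is `v⁺ w⁺ v⁻ w⁻`, and it is `0` if
`v` and `w` are not interlaced. -/
noncomputable def SignedEulerSystem.interlacement {F : HalfEdgeGraph V H}
    (C : F.SignedEulerSystem) : Matrix V V ℝ :=
  Matrix.of fun v w =>
    if v = w then 0
    else if C.OccurInOrder [C.plus v, C.minus w, C.minus v, C.plus w] then 1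
    else if C.OccurInOrder [C.plus v, C.plus w, C.minus v, C.minus w] then -1
    else 0

end HalfEdgeGraph

/-! Following the circuits of `C` is a permutation σ of the half-edges that fixes the final half of
each directed edge. Each vertex has just two passages, so an Euler system with the same directions
amounts to a set S of vertices at which the outgoing halves v⁺ and v⁻ are exchanged; with τ_S this
exchange, the condition on S is that τ_S σ has the same orbits as σ (`card_respectsDirectionsOf`).

A determinant detects this condition. Put Q(ρ) = 1 - P_ρ + J, with J the indicator of lying on one
σ-cycle. The orbits of ρ = τ_S σ refine those of σ; if they agree then det Q(ρ) = det Q(σ) ≠ 0, and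
otherwise det Q(ρ) = 0. Moreover Q(τ_S σ) is a perturbation of Q(σ) of rank at most |S|, so
Sylvester's identity turns det Q(τ_S σ) / det Q(σ) into a V × V determinant with rows of I + A over
S and rows of I elsewhere (`cycleMatrix_fiberSwap_mul`). Here A_wv = x_v(w⁺) - x_v(w⁻), where x_v is
minus the indicator of the arc from v⁺ up to v⁻, and I + A is the transpose of the interlacement
matrix (`interlacement_apply`).

So each principal minor of the interlacement matrix is 1 or 0 according to whether S yields an Euler
system. Their sum over all S is the determinant of I plus that matrix, by multilinearity in the
rows. -/

namespace Equiv.Perm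

open Matrix

/-! ### Averages over the cycles of a permutation -/

section Averaging

variable {H : Type*} [Fintype H] [DecidableEq H]

/-- The average of `f` over the cycles of a permutation. -/
noncomputable def cycleAverage (σ : Perm H) (f : H → ℝ) (h : H) : ℝ :=
  (∑ k, if σ.SameCycle h k then f k else 0) / ∑ k, if σ.SameCycle h k then 1 else 0

theorem sum_sameCycle_congr (σ : Perm H) (f : H → ℝ) {h h' : H} (hh : σ.SameCycle h h') :
    (∑ k, if σ.SameCycle h k then f k else 0) = ∑ k, if σ.SameCycle h' k then f k else 0 := by
  refine Finset.sum_congr rfl fun k _ => ?_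
  have : σ.SameCycle h k ↔ σ.SameCycle h' k := ⟨hh.symm.trans, hh.trans⟩
  simp only [this]

theorem sum_sameCycle_one_pos (σ : Perm H) (h : H) :
    (0 : ℝ) < ∑ k, if σ.SameCycle h k then 1 else 0 := by
  refine Finset.sum_pos' (fun k _ => by split_ifs <;> norm_num) ⟨h, Finset.mem_univ _, ?_⟩
  rw [if_pos (SameCycle.refl σ h)]
  exact one_pos

theorem cycleAverage_congr (σ : Perm H) (f : H → ℝ) {h h' : H} (hh : σ.SameCycle h h') :
    σ.cycleAverage f h = σ.cycleAverage f h' := by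
  rw [cycleAverage, cycleAverage, sum_sameCycle_congr σ f hh, sum_sameCycle_congr σ (fun _ => 1) hh]

theorem sum_sub_cycleAverage (σ : Perm H) (f : H → ℝ) (h : H) :
    (∑ k, if σ.SameCycle h k then f k - σ.cycleAverage f k else 0) = 0 := by
  have h1 : ∀ k, (if σ.SameCycle h k then f k - σ.cycleAverage f k else 0) =
      (if σ.SameCycle h k then f k else 0) -
        σ.cycleAverage f h * (if σ.SameCycle h k then 1 else 0) := by
    intro k
    by_cases hk : σ.SameCycle h k
    · simp [hk, cycleAverage_congr σ f hk]
    · simp [hk]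
  rw [Finset.sum_congr rfl fun k _ => h1 k, Finset.sum_sub_distrib, ← Finset.mul_sum, cycleAverage,
    div_mul_cancel₀ _ (sum_sameCycle_one_pos σ h).ne', sub_self]

end Averaging

/-! ### A determinant that detects a refinement of the orbits -/

section CycleMatrix

variable {H : Type*} [Fintype H] [DecidableEq H]

/-- The matrix `1 - P + J`, where `P` is the matrix of `ρ` acting on functions and `J` is the
indicator matrix of lying on the same cycle of `σ`. -/
noncomputable def cycleMatrix (σ ρ : Perm H) : Matrix H H ℝ :=
  1 - Matrix.of (fun h k => if ρ h = k then 1 else 0) +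
    Matrix.of fun h k => if σ.SameCycle h k then 1 else 0

theorem cycleMatrix_mulVec (σ ρ : Perm H) (f : H → ℝ) (h : H) :
    (cycleMatrix σ ρ *ᵥ f) h = f h - f (ρ h) + ∑ k, if σ.SameCycle h k then f k else 0 := by
  rw [cycleMatrix, Matrix.add_mulVec, Matrix.sub_mulVec, Matrix.one_mulVec]
  simp [Matrix.mulVec, dotProduct]

/-- On a kernel vector, f grows by a constant s, its own sum over the cycle, at each step of σ.
Returning after `orderOf σ` steps forces s = 0, so f is constant on cycles with zero sums, hence
zero. -/
theorem det_cycleMatrix_self_ne_zero (σ : Perm H) : (cycleMatrix σ σ).det ≠ 0 := by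
  classical
  intro h0
  obtain ⟨f, hf, hf0⟩ := Matrix.exists_mulVec_eq_zero_iff.mpr h0
  have key : ∀ h, f h - f (σ h) + (∑ k, if σ.SameCycle h k then f k else 0) = 0 := fun h => by
    rw [← cycleMatrix_mulVec, hf0]; rfl
  have hs : ∀ h, (∑ k, if σ.SameCycle h k then f k else 0) = 0 := by
    intro h
    set s := ∑ k, if σ.SameCycle h k then f k else 0 with hs
    have hpow : ∀ n : ℕ, f ((σ ^ n) h) = f h + n * s := by
      intro n
      induction n with
      | zero => simp
      | succ n ih =>
        have h2 := key ((σ ^ n) h)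
        rw [← sum_sameCycle_congr σ f (h := h) ⟨n, by simp⟩, ← hs, ← Perm.mul_apply, ← pow_succ']
          at h2
        rw [Nat.cast_succ]
        linarith
    have h3 := hpow (orderOf σ)
    rw [pow_orderOf_eq_one] at h3
    have h4 : (orderOf σ : ℝ) ≠ 0 := by exact_mod_cast (orderOf_pos σ).ne'
    have h5 : (orderOf σ : ℝ) * s = 0 := by simpa using h3
    exact (mul_eq_zero.mp h5).resolve_left h4
  have hinv : ∀ h, f (σ h) = f h := fun h => by
    have := key h
    rw [hs] at this
    linarith
  have hpow : ∀ (n : ℕ) h, f ((σ ^ n) h) = f h := by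
    intro n
    induction n with
    | zero => simp
    | succ n ih => intro h; rw [pow_succ', Perm.mul_apply, hinv, ih]
  apply hf
  funext h
  have h1 : ∀ k, (if σ.SameCycle h k then f k else 0) =
      f h * (if σ.SameCycle h k then 1 else 0) := by
    intro k
    by_cases hk : σ.SameCycle h k
    · obtain ⟨n, rfl⟩ := hk.exists_nat_pow_eq
      simp [hpow]
    · simp [hk]
  have h2 := hs h
  rw [Finset.sum_congr rfl fun k _ => h1 k, ← Finset.mul_sum] at h2
  exact (mul_eq_zero.mp h2).resolve_right (sum_sameCycle_one_pos σ h).ne'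

/-- The indicator of the ρ-cycle of `a`, minus its σ-cycle average, is ρ-invariant and has zero sum
on every σ-cycle, so it lies in the kernel. It is nonzero because its values at `a` and `b` differ
by 1. -/
theorem det_cycleMatrix_eq_zero {σ ρ : Perm H} (hle : ∀ h k, ρ.SameCycle h k → σ.SameCycle h k)
    {a b : H} (hab : σ.SameCycle a b) (hab' : ¬ ρ.SameCycle a b) : (cycleMatrix σ ρ).det = 0 := by
  classical
  set g : H → ℝ := fun h => if ρ.SameCycle a h then 1 else 0 with hg
  refine Matrix.exists_mulVec_eq_zero_iff.mp ⟨fun h => g h - σ.cycleAverage g h, ?_, ?_⟩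
  · intro h0
    have ha := congrFun h0 a
    have hb := congrFun h0 b
    have hga : g a = 1 := by simp [hg, SameCycle.refl]
    have hgb : g b = 0 := by simp [hg, hab']
    simp only [Pi.zero_apply, hga, hgb, cycleAverage_congr σ g hab] at ha hb
    linarith
  · funext h
    have h1 : g (ρ h) = g h := by simp [hg]
    rw [cycleMatrix_mulVec, sum_sub_cycleAverage, h1,
      cycleAverage_congr σ g (hle h (ρ h) ⟨1, by simp⟩)]
    simp

/-- The cycle type lists the sizes of the nontrivial orbits, and these depend only on the orbit
partition. -/
theorem cycleType_eq_of_sameCycle_iff {σ ρ : Perm H}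
    (hs : ∀ h k, ρ.SameCycle h k ↔ σ.SameCycle h k) : ρ.cycleType = σ.cycleType := by
  have hmoved : ∀ (π : Perm H) h, h ∈ π.support ↔ ∃ k, k ≠ h ∧ π.SameCycle h k := by
    intro π h
    rw [mem_support]
    constructor
    · exact fun hh => ⟨π h, hh, 1, by simp⟩
    · rintro ⟨k, hk, hhk⟩ h0
      exact hk (hhk.eq_of_left h0).symm
  have hsupp : ρ.support = σ.support := by
    ext h; simp only [hmoved, hs]
  have hof : ∀ h, (ρ.cycleOf h).support = (σ.cycleOf h).support := by
    intro h
    ext k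
    rw [mem_support_cycleOf_iff, mem_support_cycleOf_iff, hs, hsupp]
  rw [cycleType_def, cycleType_def]
  have himg : ∀ π : Perm H, π.cycleFactorsFinset.val.map (Finset.card ∘ support) =
      ((π.support.image fun h => (π.cycleOf h).support).val.map Finset.card) := by
    intro π
    have h1 : π.cycleFactorsFinset = π.support.image π.cycleOf := by
      ext c
      rw [Finset.mem_image]
      constructor
      · intro hc
        obtain ⟨x, hx⟩ := (mem_cycleFactorsFinset_iff.mp hc).1.nonempty_support
        exact ⟨x, mem_cycleFactorsFinset_support_le hc hx,
          ((cycle_is_cycleOf hx hc)).symm⟩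
      · rintro ⟨x, hx, rfl⟩
        exact cycleOf_mem_cycleFactorsFinset_iff.mpr hx
    have h2 : (π.support.image fun h => (π.cycleOf h).support) =
        π.cycleFactorsFinset.image support := by
      rw [h1, Finset.image_image]; rfl
    rw [h2, Finset.image_val_of_injOn, Multiset.map_map]
    intro c hc d hd hcd
    obtain ⟨x, hx⟩ := (mem_cycleFactorsFinset_iff.mp hc).1.nonempty_support
    rw [cycle_is_cycleOf hx hc, cycle_is_cycleOf (hcd ▸ hx : x ∈ d.support) hd]
  rw [himg, himg, hsupp]
  simp only [hof]

/-- Equal cycle types make ρ and σ conjugate. The conjugating bijection carries orbits to orbits, so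
it preserves the common indicator term, and reindexing by it turns one matrix into the other. -/
theorem det_cycleMatrix_eq_of_sameCycle_iff {σ ρ : Perm H}
    (hs : ∀ h k, ρ.SameCycle h k ↔ σ.SameCycle h k) :
    (cycleMatrix σ ρ).det = (cycleMatrix σ σ).det := by
  classical
  obtain ⟨g, hg⟩ := isConj_iff.mp (isConj_iff_cycleType_eq.mpr (cycleType_eq_of_sameCycle_iff hs))
  have hg' : ∀ h, σ (g h) = g (ρ h) := fun h => by rw [← hg]; simp
  rw [← Matrix.det_submatrix_equiv_self g (cycleMatrix σ σ)]
  congr 1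
  ext h k
  have h1 : σ.SameCycle (g h) (g k) ↔ σ.SameCycle h k := by
    rw [← hs h k, ← hg, sameCycle_conj]; simp
  simp [cycleMatrix, hg', h1, Matrix.one_apply]

end CycleMatrix

/-! ### Exchanging two points in each fibre -/

section VertexSwap

variable {V H : Type*} [DecidableEq V] [DecidableEq H]

/-- Exchange the points `p v` and `m v` of the fibre over `v`, for each `v ∈ S`. -/
def fiberSwap (vert : H → V) (p m : V → H) (hp : ∀ v, vert (p v) = v) (hm : ∀ v, vert (m v) = v)
    (S : Finset V) : Perm H :=
  have hvert : ∀ h, vert (swap (p (vert h)) (m (vert h)) h) = vert h := fun h => by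
    rw [swap_apply_def]; split_ifs <;> simp [hp, hm]
  have hinv : Function.Involutive fun h =>
      if vert h ∈ S then swap (p (vert h)) (m (vert h)) h else h := fun h => by
    by_cases hS : vert h ∈ S
    · simp [hS, hvert]
    · simp [hS]
  hinv.toPerm

variable {vert : H → V} {p m : V → H} (hp : ∀ v, vert (p v) = v) (hm : ∀ v, vert (m v) = v)

theorem fiberSwap_apply (S : Finset V) (h : H) : fiberSwap vert p m hp hm S h =
    if vert h ∈ S then swap (p (vert h)) (m (vert h)) h else h := rfl

theorem vert_fiberSwap (S : Finset V) (h : H) : vert (fiberSwap vert p m hp hm S h) = vert h := by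
  rw [fiberSwap_apply, swap_apply_def]
  split_ifs <;> simp [hp, hm]

theorem sum_fiberSwap [Fintype V] (hne : ∀ v, p v ≠ m v) (S : Finset V) (f : H → ℝ) (h : H) :
    f h - f (fiberSwap vert p m hp hm S h) =
      ∑ v, ((if h = p v then 1 else 0) - (if h = m v then 1 else 0)) *
        if v ∈ S then f (p v) - f (m v) else 0 := by
  rw [Finset.sum_eq_single (vert h), fiberSwap_apply, swap_apply_def]
  · have := hne (vert h)
    by_cases h1 : h = p (vert h)
    · have h2 : h ≠ m (vert h) := fun e => this (h1.symm.trans e)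
      by_cases hS : vert h ∈ S <;> simp [hS, ← h1, h2]
    · by_cases h2 : h = m (vert h)
      · have h3 : p (vert h) ≠ h := Ne.symm h1
        by_cases hS : vert h ∈ S <;> simp [hS, ← h2, h1]
      · simp [h1, h2]
  · intro v _ hv
    have h1 : h ≠ p v := fun hh => hv (by rw [hh, hp])
    have h2 : h ≠ m v := fun hh => hv (by rw [hh, hm])
    simp [h1, h2]
  · simp

variable [Fintype V] [Fintype H]

/-- The perturbation factors through the differences f(p v) - f(m v) with v ∈ S. The potentials `x
v` invert the unperturbed matrix on the vectors involved, so Sylvester's identity applies with no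
explicit inverse. -/
theorem cycleMatrix_fiberSwap_mul {σ : Perm H} (hne : ∀ v, p v ≠ m v)
    (hσ : ∀ v, σ.SameCycle (p v) (m v)) {x : V → H → ℝ}
    (hx : ∀ v h, x v h - x v (σ h) = (if σ h = p v then 1 else 0) - if σ h = m v then 1 else 0)
    (S : Finset V) :
    (cycleMatrix σ (fiberSwap vert p m hp hm S * σ)).det = (cycleMatrix σ σ).det *
      Matrix.det (S.piecewise
        (fun w v => (if w = v then 1 else 0) + (x v (p w) - x v (m w)))
        (fun w v => if w = v then 1 else 0) : Matrix V V ℝ) := by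
  classical
  -- Removing the cycle average kills the same-cycle term of the matrix. It does not change the
  -- differences between `p w` and `m w`, which share a cycle.
  let X : Matrix H V ℝ := Matrix.of fun h v => x v h - σ.cycleAverage (x v) h
  let U : Matrix V H ℝ := Matrix.of fun v h =>
    if v ∈ S then (if h = p v then 1 else 0) - (if h = m v then 1 else 0) else 0
  have hU : ∀ (f : H → ℝ) v, (U *ᵥ f) v = if v ∈ S then f (p v) - f (m v) else 0 := by
    intro f v
    by_cases hv : v ∈ S <;> simp [U, hv, Matrix.mulVec, dotProduct, sub_mul, Finset.sum_sub_distrib]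
  have hQ : cycleMatrix σ (fiberSwap vert p m hp hm S * σ) = cycleMatrix σ σ * (1 + X * U) := by
    refine Matrix.mulVec_injective ?_
    funext f h
    have hQX : ∀ v, (cycleMatrix σ σ *ᵥ fun h => X h v) h =
        (if σ h = p v then 1 else 0) - if σ h = m v then 1 else 0 := by
      intro v
      rw [cycleMatrix_mulVec]
      simp only [X, Matrix.of_apply]
      rw [sum_sub_cycleAverage, ← hx, cycleAverage_congr σ (x v) (h := h) (h' := σ h) ⟨1, by simp⟩]
      ring
    have h1 : (cycleMatrix σ σ *ᵥ (X *ᵥ (U *ᵥ f))) h =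
        ∑ v, ((if σ h = p v then 1 else 0) - if σ h = m v then 1 else 0) *
          if v ∈ S then f (p v) - f (m v) else 0 := by
      rw [Matrix.mulVec_mulVec]
      simp only [Matrix.mulVec, dotProduct] at hQX hU ⊢
      simp only [Matrix.mul_apply, hQX, hU]
    rw [← Matrix.mulVec_mulVec, Matrix.add_mulVec, Matrix.one_mulVec, Matrix.mulVec_add,
      ← Matrix.mulVec_mulVec, Pi.add_apply, h1, ← sum_fiberSwap hp hm hne, cycleMatrix_mulVec,
      cycleMatrix_mulVec, Perm.mul_apply]
    ring
  rw [hQ, Matrix.det_mul, Matrix.det_one_add_mul_comm]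
  congr 2
  ext w v
  have h1 : (U * X) w v = if w ∈ S then X (p w) v - X (m w) v else 0 := hU (fun h => X h v) w
  rw [Matrix.add_apply, h1, Matrix.one_apply]
  by_cases hw : w ∈ S
  · simp [hw, X, cycleAverage_congr σ (x v) (hσ w)]
  · simp [hw]

/-- The number of ways to exchange fibre points without splitting a cycle is a determinant. -/
theorem card_sameCycle_fiberSwap_mul {σ : Perm H} (hne : ∀ v, p v ≠ m v)
    (hσ : ∀ v, σ.SameCycle (p v) (m v)) {x : V → H → ℝ}
    (hx : ∀ v h, x v h - x v (σ h) = (if σ h = p v then 1 else 0) - if σ h = m v then 1 else 0) :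
    (Nat.card {S : Finset V // ∀ h k,
      (fiberSwap vert p m hp hm S * σ).SameCycle h k ↔ σ.SameCycle h k} : ℝ) =
      Matrix.det (1 + Matrix.of fun w v =>
        (if w = v then 1 else 0) + (x v (p w) - x v (m w)) : Matrix V V ℝ) := by
  classical
  -- An exchange stays within a σ-cycle by `hσ`, so orbits can only be refined.
  have hle : ∀ S h k, (fiberSwap vert p m hp hm S * σ).SameCycle h k → σ.SameCycle h k := by
    intro S h k hhk
    have hstep : ∀ h, σ.SameCycle h ((fiberSwap vert p m hp hm S * σ) h) := by
      intro h
      refine SameCycle.trans (y := σ h) ⟨1, by simp⟩ ?_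
      rw [Perm.mul_apply, fiberSwap_apply, swap_apply_def]
      split_ifs with h1 h2 h3
      · have := hσ (vert (σ h))
        rwa [← h2] at this
      · have := (hσ (vert (σ h))).symm
        rwa [← h3] at this
      all_goals exact SameCycle.refl _ _
    obtain ⟨n, rfl⟩ := hhk.exists_nat_pow_eq
    induction n with
    | zero => exact SameCycle.refl _ _
    | succ n ih =>
      rw [pow_succ', Perm.mul_apply _ (_ ^ n)]
      exact (ih ⟨n, by simp⟩).trans (hstep _)
  have hdet : ∀ S : Finset V, Matrix.det (S.piecewise
        (fun w v => (if w = v then 1 else 0) + (x v (p w) - x v (m w)))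
        (fun w v => if w = v then 1 else 0) : Matrix V V ℝ) =
      if ∀ h k, (fiberSwap vert p m hp hm S * σ).SameCycle h k ↔ σ.SameCycle h k
        then 1 else 0 := by
    intro S
    have h1 := cycleMatrix_fiberSwap_mul hp hm hne hσ hx S
    have h2 := det_cycleMatrix_self_ne_zero σ
    split_ifs with hS
    · rw [det_cycleMatrix_eq_of_sameCycle_iff hS] at h1
      exact (mul_eq_left₀ h2).mp h1.symm
    · push Not at hS
      obtain ⟨a, b, hab | hab⟩ := hS
      · exact absurd (hle S a b hab.1) hab.2
      · rw [det_cycleMatrix_eq_zero (hle S) hab.2 hab.1] at h1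
        exact (mul_eq_zero.mp h1.symm).resolve_left h2
  -- Multilinearity: the determinant of a sum of two matrices is the sum over all ways of taking the
  -- rows in S from the first and the others from the second.
  have hsum := (Matrix.detRowAlternating (R := ℝ) (n := V)).map_add_univ
    (fun w v => (if w = v then 1 else 0) + (x v (p w) - x v (m w)))
    (fun w v => if w = v then 1 else 0)
  have hone : (1 + Matrix.of fun w v =>
        (if w = v then 1 else 0) + (x v (p w) - x v (m w)) : Matrix V V ℝ) =
      (fun w v => (if w = v then 1 else 0) + (x v (p w) - x v (m w))) +
      (fun w v => if w = v then 1 else 0) := by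
    ext w v
    exact (Matrix.add_apply _ _ _ _).trans (by rw [Matrix.one_apply, add_comm]; rfl)
  rw [hone]
  refine Eq.trans ?_ hsum.symm
  rw [Nat.card_eq_fintype_card, Fintype.card_subtype, Finset.card_filter]
  push_cast
  exact Finset.sum_congr rfl fun S _ => (hdet S).symm

end VertexSwap

end Equiv.Perm

/-! ### Rotations, sublists and arcs of duplicate-free lists -/

namespace List

variable {α : Type*}

theorem IsRotated.eq_of_nodup_cons {a : α} {s t : List α} (h : (a :: s) ~r (a :: t))
    (hn : (a :: s).Nodup) : s = t := by
  obtain ⟨n, hr⟩ := h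
  rw [← List.rotate_mod] at hr
  have hlt : n % (a :: s).length < (a :: s).length := Nat.mod_lt _ (by simp)
  have h0 := congrArg (fun l => l[0]?) hr
  simp only [List.getElem?_rotate (show 0 < (a :: s).length by simp), Nat.zero_add, Nat.mod_mod,
    List.getElem?_cons_zero] at h0
  rw [List.getElem?_eq_getElem hlt, Option.some_inj] at h0
  have h1 : n % (a :: s).length = 0 :=
    (hn.getElem_inj_iff (hj := by simp)).mp (h0.trans (by simp))
  rw [h1, List.rotate_zero] at hr
  exact (List.cons.inj hr).2

theorem Sublist.of_cons_append_cons {a : α} {s x y : List α} (h : (a :: s).Sublist (x ++ a :: y))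
    (hx : a ∉ x) : s.Sublist y := by
  induction x with
  | nil => exact List.cons_sublist_cons.mp h
  | cons z x ih =>
    rw [List.mem_cons, not_or] at hx
    exact ih (h.of_cons_of_ne hx.1) hx.2

theorem Nodup.triple_sublist_iff {x m y : α} {l₁ l₂ : List α} (hn : (l₁ ++ m :: l₂).Nodup) :
    [x, m, y].Sublist (l₁ ++ m :: l₂) ↔ x ∈ l₁ ∧ y ∈ l₂ := by
  have hm := List.nodup_middle.mp hn
  rw [List.nodup_cons, List.mem_append, not_or] at hm
  constructor
  · intro h
    obtain ⟨s₁, s₂, hs, h₁, h₂⟩ := List.sublist_append_iff.mp h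
    rcases s₁ with _ | ⟨x', _ | ⟨m', s₁⟩⟩
    · rw [List.nil_append] at hs
      subst hs
      by_cases hx : x = m
      · subst hx
        exact absurd ((List.cons_sublist_cons.mp h₂).subset (by simp)) hm.1.2
      · exact absurd ((h₂.of_cons_of_ne hx).subset (by simp)) hm.1.2
    · simp only [List.cons_append, List.nil_append, List.cons.injEq] at hs
      obtain ⟨rfl, rfl⟩ := hs
      exact ⟨h₁.subset (by simp), (List.cons_sublist_cons.mp h₂).subset (by simp)⟩
    · simp only [List.cons_append, List.cons.injEq] at hs
      exact absurd (h₁.subset (by simp [hs.2.1])) hm.1.1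
  · rintro ⟨hx, hy⟩
    exact (List.singleton_sublist.mpr hx).append ((List.singleton_sublist.mpr hy).cons_cons m)

variable [DecidableEq α]

/-- Going once around, the arc `p :: l₁` is entered exactly at `p` and left exactly at `m`. -/
theorem formPerm_mem_cons_sub {p m : α} {l₁ l₂ : List α} (hn : (p :: l₁ ++ m :: l₂).Nodup) (h : α) :
    ((if (p :: l₁ ++ m :: l₂).formPerm h ∈ p :: l₁ then 1 else 0) -
        (if h ∈ p :: l₁ then 1 else 0) : ℝ) =
      (if (p :: l₁ ++ m :: l₂).formPerm h = p then 1 else 0) -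
        (if (p :: l₁ ++ m :: l₂).formPerm h = m then 1 else 0) := by
  by_cases hh : h ∈ p :: l₁ ++ m :: l₂
  · obtain ⟨i, hi, rfl⟩ := List.getElem_of_mem hh
    rw [List.formPerm_apply_getElem _ hn i hi]
    have hL : (p :: l₁ ++ m :: l₂).length = l₁.length + 1 + (l₂.length + 1) := by simp; omega
    have hmem : ∀ k (hk : k < (p :: l₁ ++ m :: l₂).length),
        (p :: l₁ ++ m :: l₂)[k] ∈ p :: l₁ ↔ k < l₁.length + 1 := by
      intro k hk
      constructor
      · intro hkm
        obtain ⟨k', hk', he⟩ := List.getElem_of_mem hkm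
        rw [← List.getElem_append_left (bs := m :: l₂) (h' := by simp at hk' ⊢; omega)] at he
        have := hn.getElem_inj_iff.mp he
        simp at hk'
        omega
      · intro hk'
        rw [List.getElem_append_left (by simpa using hk')]
        exact List.getElem_mem _
    have hp : ∀ k (hk : k < (p :: l₁ ++ m :: l₂).length),
        (p :: l₁ ++ m :: l₂)[k] = p ↔ k = 0 := fun k hk =>
      hn.getElem_inj_iff (hj := by omega) (j := 0)
    have hm : ∀ k (hk : k < (p :: l₁ ++ m :: l₂).length),
        (p :: l₁ ++ m :: l₂)[k] = m ↔ k = l₁.length + 1 := fun k hk => by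
      rw [← hn.getElem_inj_iff (hi := hk) (hj := by omega)]
      simp
    simp only [hmem, hp, hm]
    generalize hj : (i + 1) % (p :: l₁ ++ m :: l₂).length = j
    rcases (show i + 1 < (p :: l₁ ++ m :: l₂).length ∨ i + 1 = (p :: l₁ ++ m :: l₂).length by omega)
      with h1 | h1
    · rw [Nat.mod_eq_of_lt h1] at hj
      subst hj
      split_ifs <;> first | contradiction | omega | norm_num
    -- The last entry lies outside the arc and its successor wraps around to `p`.
    · rw [h1, Nat.mod_self] at hj
      subst hj
      split_ifs <;> first | contradiction | omega | norm_num
  · rw [List.formPerm_apply_of_notMem hh]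
    simp only [List.mem_append, not_or, List.mem_cons] at hh ⊢
    simp [hh]

end List

/-! ### Cyclic sequences and their successor permutations -/

namespace Cycle

variable {α : Type*}

theorem exists_eq_cons_of_mem {c : Cycle α} {a : α} (h : a ∈ c) :
    ∃ t : List α, c = ((a :: t : List α) : Cycle α) := by
  induction c using Quotient.inductionOn' with
  | h l =>
    obtain ⟨x, y, rfl⟩ := List.append_of_mem (show a ∈ l from h)
    exact ⟨y ++ x, Cycle.coe_eq_coe.mpr List.isRotated_append⟩

variable [DecidableEq α]

theorem Chain.rel_formPerm {r : α → α → Prop} {c : Cycle α} (hc : c.Chain r) (hn : c.Nodup) {a : α}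
    (ha : a ∈ c) : r a (c.formPerm hn a) := by
  obtain ⟨t, rfl⟩ := exists_eq_cons_of_mem ha
  change r a ((a :: t).formPerm a)
  rw [Cycle.chain_coe_cons] at hc
  rcases t with _ | ⟨b, t⟩
  · simpa using hc
  · rw [List.formPerm_apply_head _ _ _ hn]
    simp only [List.cons_append, List.isChain_cons_cons] at hc
    exact hc.1

theorem chain_of_rel_formPerm {r : α → α → Prop} {l : List α} (hn : l.Nodup)
    (h : ∀ a ∈ l, r a (l.formPerm a)) : (l : Cycle α).Chain r := by
  rcases l with _ | ⟨a, t⟩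
  · exact Cycle.Chain.nil r
  rw [Cycle.chain_coe_cons, ← List.cons_append, List.isChain_iff_getElem]
  intro i hi
  have hi' : i < (a :: t).length := by simp at hi ⊢; omega
  have h1 := h _ (List.getElem_mem hi')
  rw [List.formPerm_apply_getElem _ hn i hi'] at h1
  convert h1 using 1
  · rw [List.getElem_append_left hi']
  · rcases (show i + 1 < (a :: t).length ∨ i + 1 = (a :: t).length by omega) with h2 | h2
    · simp only [Nat.mod_eq_of_lt h2, List.getElem_append_left h2]
    · simp only [h2, Nat.mod_self]
      simp

theorem exists_pow_formPerm_eq {c : Cycle α} (hn : c.Nodup) {a b : α} (ha : a ∈ c) (hb : b ∈ c) :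
    ∃ n : ℕ, ((c.formPerm hn) ^ n) a = b := by
  obtain ⟨t, rfl⟩ := exists_eq_cons_of_mem ha
  obtain ⟨n, hlt, hnb⟩ := List.getElem_of_mem (Cycle.mem_coe_iff.mp hb)
  refine ⟨n, ?_⟩
  change ((a :: t).formPerm ^ n) a = b
  rw [List.formPerm_pow_apply_head _ _ hn]
  simp only [Nat.mod_eq_of_lt hlt, hnb]

theorem formPerm_apply_mem {c : Cycle α} (hn : c.Nodup) {a : α} (ha : a ∈ c) :
    c.formPerm hn a ∈ c := by
  rw [Cycle.formPerm_apply_mem_eq_next c hn a ha]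
  exact Cycle.next_mem c hn a ha

end Cycle

/-! ### Edge directions and the successor permutation of an Euler system -/

namespace HalfEdgeGraph

variable {V H : Type*} {F : HalfEdgeGraph V H}

theorem IsRegular.finite [Finite V] {d : ℕ} (hF : F.IsRegular d) (hd : d ≠ 0) : Finite H :=
  have (v : V) : Finite {h : H // F.vert h = v} :=
    Nat.finite_of_card_ne_zero (by rw [hF v]; exact hd)
  Finite.of_equiv _ (Equiv.sigmaFiberEquiv F.vert)

namespace EulerSystem

variable (C : F.EulerSystem)

theorem componentOf_eq_of_mem {K : F.Component} {h : H} (hh : h ∈ C.circuit K) :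
    F.componentOf h = K :=
  ((C.isEulerCircuit K).2 h).mp (Or.inl hh)

theorem mem_circuit_iff {K : F.Component} {h : H} :
    h ∈ C.circuit K ↔ h ∈ C.initialHalfEdges ∧ F.componentOf h = K := by
  constructor
  · exact fun hh => ⟨⟨K, hh⟩, C.componentOf_eq_of_mem hh⟩
  · rintro ⟨⟨K', hh⟩, rfl⟩
    rwa [C.componentOf_eq_of_mem hh]

include C in
theorem componentOf_opp (h : H) : F.componentOf (F.opp h) = F.componentOf h :=
  ((C.isEulerCircuit _).2 _).mp (by
    rw [F.opp_opp]; exact (((C.isEulerCircuit (F.componentOf h)).2 h).mpr rfl).symm)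

theorem opp_mem_initialHalfEdges_iff {h : H} :
    F.opp h ∈ C.initialHalfEdges ↔ h ∉ C.initialHalfEdges := by
  have h1 := ((C.isEulerCircuit (F.componentOf h)).2 h).mpr rfl
  have h2 := (C.isEulerCircuit (F.componentOf h)).1.2.2 h
  simp only [mem_circuit_iff, C.componentOf_opp, and_true] at h1 h2
  tauto

/-- Both sets contain exactly one half of each edge, so inclusion forces equality. -/
theorem RespectsDirectionsOf.initialHalfEdges_eq {C C' : F.EulerSystem}
    (hC : C'.RespectsDirectionsOf C) : C'.initialHalfEdges = C.initialHalfEdges := by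
  ext h
  have h1 : ∀ h, h ∈ C'.initialHalfEdges → h ∈ C.initialHalfEdges := fun h ⟨K, hK⟩ => hC K h hK
  refine ⟨h1 h, fun hh => ?_⟩
  by_contra hn
  exact C.opp_mem_initialHalfEdges_iff.mp (h1 _ (C'.opp_mem_initialHalfEdges_iff.mpr hn)) hh

/-- A circuit repeats no half-edge, so it has a unique linear form that starts at `a`. -/
theorem occurInOrder_cons_iff {K : F.Component} {a : H} {s t : List H}
    (ht : C.circuit K = ((a :: t : List H) : Cycle H)) :
    C.OccurInOrder (a :: s) ↔ s.Sublist t := by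
  constructor
  · rintro ⟨K', l, hl, hs⟩
    have hal : a ∈ l := hs.subset (by simp)
    have hK : K' = K := by
      have h1 : a ∈ C.circuit K' := hl ▸ hal
      have h2 : a ∈ C.circuit K := by rw [ht]; simp
      rw [← C.componentOf_eq_of_mem h1, C.componentOf_eq_of_mem h2]
    subst hK
    obtain ⟨x, y, rfl⟩ := List.append_of_mem hal
    have hn : (x ++ a :: y).Nodup := by
      have := (C.isEulerCircuit K').1.2.1
      rwa [← hl] at this
    have hr : (a :: (y ++ x)) ~r (a :: t) :=
      (List.isRotated_append (l := a :: y) (l' := x)).trans (Cycle.coe_eq_coe.mp (hl.trans ht))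
    have hn' : (a :: (y ++ x)).Nodup := by
      rw [← List.cons_append]; exact (List.isRotated_append.nodup_iff).mp hn
    have hax : a ∉ x := fun hx => (List.nodup_cons.mp hn').1 (by simp [hx])
    rw [← hr.eq_of_nodup_cons hn']
    exact (hs.of_cons_append_cons hax).trans (List.sublist_append_left _ _)
  · exact fun h => ⟨K, a :: t, ht.symm, h.cons_cons a⟩

section Successor

variable [DecidableEq H]

/-- The permutation that follows the circuit of one component. -/
def circuitPerm (K : F.Component) : Equiv.Perm H :=
  (C.circuit K).formPerm (C.isEulerCircuit K).1.2.1

theorem componentOf_circuitPerm (K : F.Component) (h : H) :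
    F.componentOf (C.circuitPerm K h) = F.componentOf h := by
  by_cases hh : h ∈ C.circuit K
  · rw [C.componentOf_eq_of_mem hh]
    exact C.componentOf_eq_of_mem (Cycle.formPerm_apply_mem _ hh)
  · rw [circuitPerm, Cycle.formPerm_eq_self_of_notMem _ _ _ hh]

/-- The permutation that sends each directed edge of an Euler system to the next one, and fixes
the opposite half-edges. -/
def succ : Equiv.Perm H where
  toFun h := C.circuitPerm (F.componentOf h) h
  invFun h := (C.circuitPerm (F.componentOf h)).symm h
  left_inv h := by
    simp only [C.componentOf_circuitPerm, Equiv.symm_apply_apply]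
  right_inv h := by
    have h1 := C.componentOf_circuitPerm (F.componentOf h)
      ((C.circuitPerm (F.componentOf h)).symm h)
    rw [Equiv.apply_symm_apply] at h1
    simp only [← h1, Equiv.apply_symm_apply]

theorem succ_apply (h : H) : C.succ h = C.circuitPerm (F.componentOf h) h := rfl

theorem componentOf_succ (h : H) : F.componentOf (C.succ h) = F.componentOf h :=
  C.componentOf_circuitPerm _ h

theorem succ_apply_of_notMem {h : H} (hh : h ∉ C.initialHalfEdges) : C.succ h = h :=
  Cycle.formPerm_eq_self_of_notMem _ _ _ fun hc => hh ⟨_, hc⟩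

theorem succ_mem_initialHalfEdges {h : H} (hh : h ∈ C.initialHalfEdges) :
    C.succ h ∈ C.initialHalfEdges :=
  ⟨_, Cycle.formPerm_apply_mem _ (C.mem_circuit_iff.mpr ⟨hh, rfl⟩)⟩

theorem succ_mem_initialHalfEdges_iff {h : H} :
    C.succ h ∈ C.initialHalfEdges ↔ h ∈ C.initialHalfEdges := by
  refine ⟨fun hh => ?_, C.succ_mem_initialHalfEdges⟩
  by_contra hn
  rw [C.succ_apply_of_notMem hn] at hh
  exact hn hh

theorem vert_succ {h : H} (hh : h ∈ C.initialHalfEdges) :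
    F.vert (C.succ h) = F.vert (F.opp h) :=
  ((C.isEulerCircuit _).1.1.rel_formPerm (C.isEulerCircuit _).1.2.1
    (C.mem_circuit_iff.mpr ⟨hh, rfl⟩)).symm

theorem succ_pow_apply (n : ℕ) (h : H) : (C.succ ^ n) h =
    (C.circuitPerm (F.componentOf h) ^ n) h := by
  have hcomp : ∀ n : ℕ, F.componentOf ((C.succ ^ n) h) = F.componentOf h := by
    intro n
    induction n with
    | zero => rfl
    | succ n ih => rw [pow_succ', Equiv.Perm.mul_apply, C.componentOf_succ, ih]
  induction n with
  | zero => rfl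
  | succ n ih =>
    rw [pow_succ', Equiv.Perm.mul_apply, C.succ_apply, pow_succ', Equiv.Perm.mul_apply, ← ih]
    simp only [hcomp]

theorem sameCycle_succ_iff [Finite H] {h k : H} : C.succ.SameCycle h k ↔
    h = k ∨ (h ∈ C.initialHalfEdges ∧ k ∈ C.initialHalfEdges ∧
      F.componentOf h = F.componentOf k) := by
  constructor
  · intro hs
    obtain ⟨n, rfl⟩ := hs.exists_nat_pow_eq
    by_cases hh : h ∈ C.initialHalfEdges
    · refine Or.inr ⟨hh, ?_⟩
      clear hs
      induction n with
      | zero => exact ⟨hh, rfl⟩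
      | succ n ih =>
        rw [pow_succ', Equiv.Perm.mul_apply, C.componentOf_succ]
        exact ⟨C.succ_mem_initialHalfEdges ih.1, ih.2⟩
    · exact Or.inl (Equiv.Perm.pow_apply_eq_self_of_apply_eq_self (C.succ_apply_of_notMem hh) n).symm
  · rintro (rfl | ⟨hh, hk, hc⟩)
    · exact Equiv.Perm.SameCycle.refl _ _
    · obtain ⟨n, hn⟩ := Cycle.exists_pow_formPerm_eq (C.isEulerCircuit (F.componentOf h)).1.2.1
        (C.mem_circuit_iff.mpr ⟨hh, rfl⟩) (C.mem_circuit_iff.mpr ⟨hk, hc.symm⟩)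
      exact ⟨n, by rw [zpow_natCast, C.succ_pow_apply]; exact hn⟩

end Successor

end EulerSystem

/-! ### The two passages through each vertex, and interlacement -/

namespace SignedEulerSystem

variable (C : F.SignedEulerSystem)

theorem componentOf_plus (v : V) :
    F.componentOf (C.plus v) = F.toSimpleGraph.connectedComponentMk v := by
  rw [componentOf, C.vert_plus]

theorem componentOf_minus (v : V) :
    F.componentOf (C.minus v) = F.toSimpleGraph.connectedComponentMk v := by
  rw [componentOf, C.vert_minus]

theorem sameCycle_plus_minus [DecidableEq H] [Finite H] (v : V) :
    C.succ.SameCycle (C.plus v) (C.minus v) :=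
  C.sameCycle_succ_iff.mpr (Or.inr ⟨C.plus_mem v, C.minus_mem v, by
    rw [C.componentOf_plus, C.componentOf_minus]⟩)

/-- Passing from an incoming half-edge to the outgoing one that follows it is a bijection at the
vertex. Hence two of the four half-edges are outgoing, and `plus` and `minus` exhaust them. -/
theorem eq_plus_or_minus (hF : F.IsRegular 4) [Finite H] {h : H}
    (hh : h ∈ C.initialHalfEdges) : h = C.plus (F.vert h) ∨ h = C.minus (F.vert h) := by
  classical
  have := Fintype.ofFinite H
  set v := F.vert h with hv
  set A := Finset.univ.filter fun k => k ∈ C.initialHalfEdges ∧ F.vert k = v with hA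
  set B := Finset.univ.filter fun k => k ∉ C.initialHalfEdges ∧ F.vert k = v with hB
  have hAB : A.card + B.card = 4 := by
    rw [← hF v, Nat.card_eq_fintype_card, Fintype.card_subtype, ← Finset.card_union_of_disjoint]
    · congr 1
      ext k
      simp only [hA, hB, Finset.mem_union, Finset.mem_filter, Finset.mem_univ, true_and]
      tauto
    · rw [Finset.disjoint_filter]
      tauto
  have hBA : B.card = A.card := by
    refine Finset.card_bij (fun k _ => C.succ (F.opp k)) ?_ ?_ ?_
    · intro k hk
      simp only [hA, hB, Finset.mem_filter, Finset.mem_univ, true_and] at hk ⊢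
      have h1 := C.opp_mem_initialHalfEdges_iff.mpr hk.1
      rw [C.vert_succ h1, F.opp_opp]
      exact ⟨C.succ_mem_initialHalfEdges h1, hk.2⟩
    · intro k _ k' _ hkk
      rw [← F.opp_opp k, C.succ.injective hkk, F.opp_opp]
    · intro k hk
      simp only [hA, hB, Finset.mem_filter, Finset.mem_univ, true_and] at hk ⊢
      have h1 : C.succ.symm k ∈ C.initialHalfEdges := by
        rw [← C.succ_mem_initialHalfEdges_iff, Equiv.apply_symm_apply]
        exact hk.1
      refine ⟨F.opp (C.succ.symm k), ⟨?_, ?_⟩, ?_⟩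
      · rw [← C.opp_mem_initialHalfEdges_iff, F.opp_opp]
        exact h1
      · rw [← C.vert_succ h1, Equiv.apply_symm_apply]
        exact hk.2
      · rw [F.opp_opp, Equiv.apply_symm_apply]
  have hsub : ({C.plus v, C.minus v} : Finset H) ⊆ A := by
    intro k hk
    simp only [Finset.mem_insert, Finset.mem_singleton] at hk
    simp only [hA, Finset.mem_filter, Finset.mem_univ, true_and]
    rcases hk with rfl | rfl
    · exact ⟨C.plus_mem v, C.vert_plus v⟩
    · exact ⟨C.minus_mem v, C.vert_minus v⟩
  have heq := Finset.eq_of_subset_of_card_le hsub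
    (by rw [Finset.card_pair (C.plus_ne_minus v)]; omega)
  have hmem : h ∈ A := by simp [hA, hh, hv]
  rw [← heq] at hmem
  simpa using hmem

section Interlacement

/-- The circuit through `v`, cut open at the two passages through `v`. -/
theorem exists_circuit_eq (v : V) : ∃ l₁ l₂ : List H,
    C.circuit (F.toSimpleGraph.connectedComponentMk v) =
      ((C.plus v :: l₁ ++ C.minus v :: l₂ : List H) : Cycle H) := by
  obtain ⟨t, ht⟩ := Cycle.exists_eq_cons_of_mem
    (C.mem_circuit_iff.mpr ⟨C.plus_mem v, C.componentOf_plus v⟩)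
  have hm := C.mem_circuit_iff.mpr ⟨C.minus_mem v, C.componentOf_minus v⟩
  rw [ht, Cycle.mem_coe_iff, List.mem_cons] at hm
  obtain ⟨x, y, rfl⟩ := List.append_of_mem (hm.resolve_left (C.plus_ne_minus v).symm)
  exact ⟨x, y, ht⟩

/-- The directed edges between the passages `v⁺` and `v⁻`. -/
noncomputable def arc (v : V) : List H := C.plus v :: (C.exists_circuit_eq v).choose

theorem arc_spec (v : V) : ∃ l₁ l₂ : List H, C.arc v = C.plus v :: l₁ ∧
    (C.plus v :: l₁ ++ C.minus v :: l₂).Nodup ∧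
    C.circuit (F.toSimpleGraph.connectedComponentMk v) =
      ((C.plus v :: l₁ ++ C.minus v :: l₂ : List H) : Cycle H) := by
  obtain ⟨l₂, h⟩ := (C.exists_circuit_eq v).choose_spec
  refine ⟨_, l₂, rfl, ?_, h⟩
  have := (C.isEulerCircuit (F.toSimpleGraph.connectedComponentMk v)).1.2.1
  rwa [h] at this

open Classical in
-- This supplies the potential required by the determinant formula: minus the indicator of the arc.
theorem arc_indicator_sub (v : V) (h : H) :
    (-(if h ∈ C.arc v then 1 else 0) - -(if C.succ h ∈ C.arc v then 1 else 0) : ℝ) =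
      (if C.succ h = C.plus v then 1 else 0) - if C.succ h = C.minus v then 1 else 0 := by
  obtain ⟨l₁, l₂, ha, hn, hc⟩ := C.arc_spec v
  have hmem : ∀ k, k ∈ C.plus v :: l₁ ++ C.minus v :: l₂ ↔ k ∈ C.initialHalfEdges ∧
      F.componentOf k = F.toSimpleGraph.connectedComponentMk v := fun k => by
    rw [← C.mem_circuit_iff, hc, Cycle.mem_coe_iff]
  rw [ha, neg_sub_neg]
  by_cases hh : h ∈ C.plus v :: l₁ ++ C.minus v :: l₂
  · have hs : C.succ h = (C.plus v :: l₁ ++ C.minus v :: l₂).formPerm h := by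
      rw [C.succ_apply]
      simp only [((hmem h).mp hh).2, EulerSystem.circuitPerm, hc]
      rfl
    rw [hs]
    exact List.formPerm_mem_cons_sub hn h
  · have hs : C.succ h ∉ C.plus v :: l₁ ++ C.minus v :: l₂ := by
      rwa [hmem, C.succ_mem_initialHalfEdges_iff, C.componentOf_succ, ← hmem]
    simp only [List.mem_append, List.mem_cons, not_or] at hh hs ⊢
    simp [hh, hs]

open Classical in
-- For w ≠ v the entry is 1 if only w⁻ lies on the arc from v⁺ to v⁻, -1 if only w⁺ does, and 0 if
-- both or neither do. On the diagonal v⁺ is on the arc and v⁻ is not, giving the -1 that the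
-- identity term cancels.
theorem interlacement_apply (v w : V) : C.interlacement v w =
    (if w = v then 1 else 0) + (-(if C.plus w ∈ C.arc v then 1 else 0) -
      -(if C.minus w ∈ C.arc v then 1 else 0)) := by
  obtain ⟨l₁, l₂, ha, hn, hc⟩ := C.arc_spec v
  have hn' := hn
  rw [List.cons_append, List.nodup_cons, List.mem_append, List.mem_cons, not_or, not_or] at hn'
  obtain ⟨⟨hp1, hpm, hp2⟩, hn2⟩ := hn'
  have hn3 := List.nodup_middle.mp hn2
  rw [List.nodup_cons, List.mem_append, not_or, List.nodup_append] at hn3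
  rw [interlacement, Matrix.of_apply, ha]
  by_cases hvw : v = w
  · subst hvw
    simp [hn3.1.1, (C.plus_ne_minus v).symm]
  · rw [List.cons_append] at hc
    rw [C.occurInOrder_cons_iff hc, C.occurInOrder_cons_iff hc, hn2.triple_sublist_iff,
      hn2.triple_sublist_iff]
    have hne : ∀ {a b : H}, F.vert a = v → F.vert b = w → b ≠ a := fun h1 h2 h3 =>
      hvw (by rw [← h1, ← h2, h3])
    have h1 := hne (C.vert_plus v) (C.vert_plus w)
    have h2 := hne (C.vert_plus v) (C.vert_minus w)
    have h3 := hne (C.vert_minus v) (C.vert_plus w)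
    have h4 := hne (C.vert_minus v) (C.vert_minus w)
    have hiff : C.plus w ∈ C.plus v :: l₁ ++ C.minus v :: l₂ ↔
        C.minus w ∈ C.plus v :: l₁ ++ C.minus v :: l₂ := by
      rw [List.cons_append, ← Cycle.mem_coe_iff, ← Cycle.mem_coe_iff, ← hc, C.mem_circuit_iff, C.mem_circuit_iff,
        C.componentOf_plus, C.componentOf_minus]
      simp [C.plus_mem, C.minus_mem]
    have hdisj : ∀ a, a ∈ l₁ → a ∉ l₂ := fun a ha hb => hn3.2.2.2 a ha a hb rfl
    have hd1 := hdisj (C.plus w)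
    have hd2 := hdisj (C.minus w)
    simp only [List.mem_append, List.mem_cons, h1, h2, h3, h4, false_or] at hiff ⊢
    simp only [hvw, Ne.symm hvw, if_false]
    by_cases e1 : C.plus w ∈ l₁ <;> by_cases e2 : C.minus w ∈ l₁ <;>
      by_cases e3 : C.plus w ∈ l₂ <;> by_cases e4 : C.minus w ∈ l₂ <;> simp_all

end Interlacement

end SignedEulerSystem

end HalfEdgeGraph

/-! ### Euler systems with given directions as sets of exchanged vertices -/

namespace HalfEdgeGraph

variable {V H : Type*} {F : HalfEdgeGraph V H}

namespace EulerSystem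

variable [DecidableEq H]

/-- A successor permutation determines a cyclic sequence only up to confusing those of length at
most one. Here every circuit contains both passages of some vertex. -/
theorem RespectsDirectionsOf.eq_of_succ_eq {C : F.SignedEulerSystem} {C₁ C₂ : F.EulerSystem}
    (h₁ : C₁.RespectsDirectionsOf C.toEulerSystem) (h₂ : C₂.RespectsDirectionsOf C.toEulerSystem)
    (hs : C₁.succ = C₂.succ) : C₁ = C₂ := by
  have hcirc : C₁.circuit = C₂.circuit := by
    funext K
    have hperm : C₁.circuitPerm K = C₂.circuitPerm K := by
      ext h
      by_cases hh : F.componentOf h = K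
      · subst hh
        exact congrArg (fun σ => σ h) hs
      · rw [circuitPerm, circuitPerm, Cycle.formPerm_eq_self_of_notMem,
          Cycle.formPerm_eq_self_of_notMem]
        · exact fun hc => hh (C₂.componentOf_eq_of_mem hc)
        · exact fun hc => hh (C₁.componentOf_eq_of_mem hc)
    refine (Cycle.formPerm_eq_formPerm_iff.mp hperm).resolve_right fun hsub => ?_
    have hn := (C₁.isEulerCircuit K).1.2.1
    refine (hn.nontrivial_iff.mp ?_) hsub.1
    obtain ⟨v, rfl⟩ : ∃ v, F.toSimpleGraph.connectedComponentMk v = K := K.exists_rep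
    refine ⟨C.plus v, C.minus v, C.plus_ne_minus v, ?_, ?_⟩ <;>
      rw [C₁.mem_circuit_iff, h₁.initialHalfEdges_eq]
    · exact ⟨C.plus_mem v, C.componentOf_plus v⟩
    · exact ⟨C.minus_mem v, C.componentOf_minus v⟩
  cases C₁
  cases C₂
  simp only at hcirc
  subst hcirc
  rfl

end EulerSystem

namespace SignedEulerSystem

variable [DecidableEq H] (C : F.SignedEulerSystem)

/-- The circuit of each component is the ρ-orbit of a base passage; equality of orbits makes it
cover the whole component. -/
theorem exists_succ_eq [Fintype H] {ρ : Equiv.Perm H}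
    (hρ : ∀ h ∈ C.initialHalfEdges, F.vert (F.opp h) = F.vert (ρ h))
    (hs : ∀ h k, ρ.SameCycle h k ↔ C.succ.SameCycle h k) :
    ∃ C' : F.EulerSystem, C'.RespectsDirectionsOf C.toEulerSystem ∧ C'.succ = ρ := by
  -- The list of a fixed point is empty, so the base passages must be moved by ρ.
  have hsupp : ∀ v, C.plus v ∈ ρ.support := by
    intro v
    rw [Equiv.Perm.mem_support]
    intro h0
    exact C.plus_ne_minus v (((hs _ _).mpr (C.sameCycle_plus_minus v)).eq_of_left h0)
  let x : F.Component → H := fun K => C.plus K.out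
  have hx : ∀ K, F.componentOf (x K) = K := fun K => by
    rw [C.componentOf_plus]; exact Quot.out_eq K
  have hmem : ∀ K h, h ∈ (ρ.toList (x K) : Cycle H) ↔
      h ∈ C.initialHalfEdges ∧ F.componentOf h = K := by
    intro K h
    rw [Cycle.mem_coe_iff, Equiv.Perm.mem_toList_iff, hs, C.sameCycle_succ_iff, hx]
    constructor
    · rintro ⟨rfl | h1, -⟩
      · exact ⟨C.plus_mem _, hx K⟩
      · exact ⟨h1.2.1, h1.2.2.symm⟩
    · rintro ⟨h1, h2⟩
      exact ⟨Or.inr ⟨C.plus_mem _, h1, h2.symm⟩, hsupp _⟩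
  have happly : ∀ K h, h ∈ C.initialHalfEdges → F.componentOf h = K →
      (ρ.toList (x K)).formPerm h = ρ h := by
    intro K h h1 h2
    rw [Equiv.Perm.formPerm_toList]
    exact Equiv.Perm.SameCycle.cycleOf_apply
      (Equiv.Perm.mem_toList_iff.mp (Cycle.mem_coe_iff.mp ((hmem K h).mpr ⟨h1, h2⟩))).1
  let C' : F.EulerSystem :=
    { circuit := fun K => (ρ.toList (x K) : Cycle H)
      isEulerCircuit := fun K => by
        refine ⟨⟨?_, Equiv.Perm.nodup_toList ρ (x K), ?_⟩, ?_⟩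
        · refine Cycle.chain_of_rel_formPerm (Equiv.Perm.nodup_toList ρ (x K)) fun h hh => ?_
          obtain ⟨h1, h2⟩ := (hmem K h).mp hh
          rw [happly K h h1 h2]
          exact hρ h h1
        · intro h hh hh'
          rw [hmem] at hh hh'
          exact C.opp_mem_initialHalfEdges_iff.mp hh'.1 hh.1
        · intro h
          rw [hmem, hmem, C.componentOf_opp, C.opp_mem_initialHalfEdges_iff]
          tauto }
  refine ⟨C', fun K h hh => ((hmem K h).mp hh).1, ?_⟩
  ext h
  by_cases hh : h ∈ C.initialHalfEdges
  · exact happly _ h hh rfl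
  · rw [C'.succ_apply_of_notMem fun ⟨K, hK⟩ => hh ((hmem K h).mp hK).1]
    have h1 := (hs h (ρ h)).mp ⟨1, by simp⟩
    rw [C.sameCycle_succ_iff] at h1
    exact h1.resolve_right fun h2 => hh h2.1

theorem sameCycle_succ_iff_of_respects [Finite H] {C' : F.EulerSystem}
    (h' : C'.RespectsDirectionsOf C.toEulerSystem) (h k : H) :
    C'.succ.SameCycle h k ↔ C.succ.SameCycle h k := by
  rw [C'.sameCycle_succ_iff, C.sameCycle_succ_iff, h'.initialHalfEdges_eq]

variable [DecidableEq V]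

/-- Exchange the passages `v⁺` and `v⁻` for each `v` in a set. -/
abbrev passageSwap (S : Finset V) : Equiv.Perm H :=
  Equiv.Perm.fiberSwap F.vert C.plus C.minus C.vert_plus C.vert_minus S

theorem passageSwap_injective : Function.Injective C.passageSwap := by
  intro S T hST
  ext v
  have h1 := congrArg (fun σ => σ (C.plus v)) hST
  have hne := C.plus_ne_minus v
  simp only [Equiv.Perm.fiberSwap_apply, C.vert_plus, Equiv.swap_apply_left] at h1
  by_cases hS : v ∈ S <;> by_cases hT : v ∈ T <;> simp_all

variable [Fintype V] [Fintype H]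

/-- The quotient of the two successor permutations preserves the outgoing half-edges at each vertex,
so it fixes or exchanges v⁺ and v⁻. -/
theorem exists_succ_eq_passageSwap_mul (hF : F.IsRegular 4) {C' : F.EulerSystem}
    (h' : C'.RespectsDirectionsOf C.toEulerSystem) :
    ∃ S : Finset V, C'.succ = C.passageSwap S * C.succ := by
  have hD := h'.initialHalfEdges_eq
  set π : Equiv.Perm H := C.succ.symm.trans C'.succ with hπ
  obtain ⟨S, hS⟩ : ∃ S : Finset V, ∀ v, v ∈ S ↔ π (C.plus v) ≠ C.plus v :=
    ⟨Finset.univ.filter fun v => π (C.plus v) ≠ C.plus v, by simp⟩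
  refine ⟨S, ?_⟩
  have key : ∀ k, π k = C.passageSwap S k := by
    have hin : ∀ k ∈ C.initialHalfEdges,
        π k ∈ C.initialHalfEdges ∧ F.vert (π k) = F.vert k := by
      intro k hk
      have h1 : C.succ.symm k ∈ C.initialHalfEdges := by
        rw [← C.succ_mem_initialHalfEdges_iff, Equiv.apply_symm_apply]
        exact hk
      have h2 : C.succ.symm k ∈ C'.initialHalfEdges := hD ▸ h1
      refine ⟨hD ▸ C'.succ_mem_initialHalfEdges h2, ?_⟩
      have h3 := C.vert_succ h1
      rw [Equiv.apply_symm_apply] at h3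
      rw [h3]
      exact C'.vert_succ h2
    have hpm : ∀ v, (π (C.plus v) = C.plus v ∧ π (C.minus v) = C.minus v) ∨
        (π (C.plus v) = C.minus v ∧ π (C.minus v) = C.plus v) := by
      intro v
      have h1 := hin _ (C.plus_mem v)
      have h2 := hin _ (C.minus_mem v)
      have h3 := C.eq_plus_or_minus hF h1.1
      have h4 := C.eq_plus_or_minus hF h2.1
      rw [h1.2, C.vert_plus] at h3
      rw [h2.2, C.vert_minus] at h4
      have h5 : π (C.plus v) ≠ π (C.minus v) := fun e => C.plus_ne_minus v (π.injective e)
      rcases h3 with h3 | h3 <;> rcases h4 with h4 | h4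
      · exact absurd (h3.trans h4.symm) h5
      · exact Or.inl ⟨h3, h4⟩
      · exact Or.inr ⟨h3, h4⟩
      · exact absurd (h3.trans h4.symm) h5
    intro k
    simp only [Equiv.Perm.fiberSwap_apply, hS]
    have hne := C.plus_ne_minus (F.vert k)
    by_cases hk : k ∈ C.initialHalfEdges
    · rcases C.eq_plus_or_minus hF hk with h1 | h1 <;> rcases hpm (F.vert k) with h2 | h2 <;>
        generalize F.vert k = v at * <;> subst h1 <;> simp [h2.1, h2.2, hne.symm]
    · have h1 : C.succ.symm k = k := by
        rw [Equiv.symm_apply_eq, C.succ_apply_of_notMem hk]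
      have h2 : π k = k := by
        change C'.succ (C.succ.symm k) = k
        rw [h1, C'.succ_apply_of_notMem (hD ▸ hk)]
      have h3 : k ≠ C.plus (F.vert k) := fun e => hk (e ▸ C.plus_mem _)
      have h4 : k ≠ C.minus (F.vert k) := fun e => hk (e ▸ C.minus_mem _)
      rw [h2, Equiv.swap_apply_of_ne_of_ne h3 h4, ite_self]
  ext h
  rw [Equiv.Perm.mul_apply, ← key, hπ, Equiv.trans_apply, Equiv.symm_apply_apply]

theorem card_respectsDirectionsOf (hF : F.IsRegular 4) :
    Nat.card {C' : F.EulerSystem // C'.RespectsDirectionsOf C.toEulerSystem} =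
      Nat.card {S : Finset V // ∀ h k,
        (C.passageSwap S * C.succ).SameCycle h k ↔ C.succ.SameCycle h k} := by
  choose S hS using fun C' : {C' : F.EulerSystem // C'.RespectsDirectionsOf C.toEulerSystem} =>
    C.exists_succ_eq_passageSwap_mul hF C'.2
  refine Nat.card_congr (Equiv.ofBijective
    (fun C' => ⟨S C', fun h k => hS C' ▸ C.sameCycle_succ_iff_of_respects C'.2 h k⟩) ⟨?_, ?_⟩)
  · intro C₁ C₂ h12
    refine Subtype.ext (C₁.2.eq_of_succ_eq C₂.2 ?_)
    rw [hS, hS, Subtype.mk.inj h12]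
  · rintro ⟨T, hT⟩
    obtain ⟨C', h', hs'⟩ := C.exists_succ_eq (ρ := C.passageSwap T * C.succ) (fun h hh => by
      rw [Equiv.Perm.mul_apply, Equiv.Perm.vert_fiberSwap C.vert_plus C.vert_minus, C.vert_succ hh]) hT
    refine ⟨⟨C', h'⟩, Subtype.ext (C.passageSwap_injective ?_)⟩
    have h1 := (hS ⟨C', h'⟩).symm.trans hs'
    exact mul_right_cancel h1

end SignedEulerSystem

end HalfEdgeGraph

theorem mainTheorem9 {V H : Type*} [Fintype V] [DecidableEq V]
    (F : HalfEdgeGraph V H) (hF : F.IsRegular 4) (C : F.SignedEulerSystem) :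
    (Nat.card {C' : F.EulerSystem // C'.RespectsDirectionsOf C.toEulerSystem} : ℝ) =
      (1 + C.interlacement).det := by
  classical
  have := hF.finite (by norm_num)
  have := Fintype.ofFinite H
  -- In the determinant formula the rows belong to the exchanged vertex `w` and the columns to the
  -- arc of `v`, hence the transpose.
  rw [C.card_respectsDirectionsOf hF, Equiv.Perm.card_sameCycle_fiberSwap_mul C.vert_plus
    C.vert_minus C.plus_ne_minus C.sameCycle_plus_minus C.arc_indicator_sub,
    ← Matrix.det_transpose (1 + C.interlacement)]
  congr 1
  ext w v
  simp only [Matrix.transpose_apply, Matrix.add_apply, Matrix.of_apply, C.interlacement_apply]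
  by_cases h : w = v
  · subst h
    simp
  · simp [h, Ne.symm h]
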